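/- Let $(M_n)_{n\ge 0}$ be a weight sequence, that is, a sequence of positive real numbers with $M_0=1$ and $\frac{M_{n+m}}{M_nM_m}\ge\binom{n+m}{n}$ for all integers $m,n\ge 0$, and let \[D([0,1],M)=\Big\{f\in C^\infty([0,1],\mathbb C):\ \|f\|_D=\sum_{n=0}^\infty\frac{\|f^{(n)}\|_\infty}{M_n}<\infty\Big\},\] an algebra under pointwise operations, normed by $\|\cdot\|_D$ (derivatives at the end points of $[0,1]$ are one-sided, and $\|\cdot\|_\infty$ is the supremum norm on $[0,1]$). Suppose that $\varphi:[0,1]\to[0,1]$ induces a compact endomorphism $T$ of $D([0,1],M)$, that is, $Tf=f\circ\varphi$ defines an algebra endomorphism of $D([0,1],M)$ which is a compact operator. Then $\varphi$ has exactly one fixed point $x_0$, and the spectrum of $T$ as a bounded linear operator on $D([0,1],M)$ is \[\sigma(T)=\{\varphi'(x_0)^n:\ n\ge 1\}\cup\{0,1\}.\] -/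

import Mathlib

open scoped ContDiff

noncomputable section

namespace DalesDavie

/-- A weight sequence: positive reals with `M 0 = 1` and
`M (n + m) / (M n * M m) ≥ (n + m).choose n` for all `m, n`. -/
structure WeightSequence where
  /-- The underlying sequence. -/
  toFun : ℕ → ℝ
  pos : ∀ n, 0 < toFun n
  map_zero : toFun 0 = 1
  choose_le : ∀ m n, ((n + m).choose n : ℝ) ≤ toFun (n + m) / (toFun n * toFun m)

instance : CoeFun WeightSequence (fun _ => ℕ → ℝ) := ⟨WeightSequence.toFun⟩

/-- A function on `[0,1]` viewed as a function on `ℝ` (constant outside `[0,1]`). Only its values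
on `[0,1]` matter below, because every derivative is taken within `[0,1]`. -/
def ext {E : Type*} (f : unitInterval → E) : ℝ → E :=
  Set.IccExtend (zero_le_one : (0 : ℝ) ≤ 1) f

/-- The `n`-th derivative of `f : [0,1] → ℂ` (one-sided at the end points). -/
def nthDeriv (n : ℕ) (f : unitInterval → ℂ) (x : unitInterval) : ℂ :=
  iteratedDerivWithin n (ext f) (Set.Icc 0 1) (x : ℝ)

/-- Infinite differentiability on `[0,1]`. -/
def IsSmooth (f : unitInterval → ℂ) : Prop :=
  ContDiffOn ℝ ∞ (ext f) (Set.Icc 0 1)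

/-- The supremum norm `‖f⁽ⁿ⁾‖_∞` over `[0,1]`. -/
def supDeriv (n : ℕ) (f : unitInterval → ℂ) : ℝ :=
  ⨆ x : unitInterval, ‖nthDeriv n f x‖

/-- Membership in `D([0,1],M)`. -/
def MemD (M : WeightSequence) (f : unitInterval → ℂ) : Prop :=
  IsSmooth f ∧ Summable (fun n => supDeriv n f / M n)

/-- The derivative of a self-map of `[0,1]` (one-sided at the end points). -/
def selfMapDeriv (φ : unitInterval → unitInterval) (x : unitInterval) : ℝ :=
  derivWithin (ext (fun t => (φ t : ℝ))) (Set.Icc 0 1) (x : ℝ)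

theorem bddAbove_nthDeriv {f : unitInterval → ℂ} (hf : IsSmooth f) (n : ℕ) :
    BddAbove (Set.range fun x : unitInterval => ‖nthDeriv n f x‖) := by
  have h := (ContDiffOn.continuousOn_iteratedDerivWithin hf (m := n)
    (by exact_mod_cast le_top) (uniqueDiffOn_Icc zero_lt_one)).norm
  obtain ⟨C, hC⟩ := isCompact_Icc.bddAbove_image h
  refine ⟨C, ?_⟩
  rintro _ ⟨x, rfl⟩
  exact hC ⟨x, x.2, rfl⟩

theorem le_supDeriv {f : unitInterval → ℂ} (hf : IsSmooth f) (n : ℕ) (x : unitInterval) :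
    ‖nthDeriv n f x‖ ≤ supDeriv n f :=
  le_ciSup (bddAbove_nthDeriv hf n) x

theorem supDeriv_nonneg (n : ℕ) (f : unitInterval → ℂ) : 0 ≤ supDeriv n f :=
  Real.iSup_nonneg fun _ => norm_nonneg _

theorem IsSmooth.add {f g : unitInterval → ℂ} (hf : IsSmooth f) (hg : IsSmooth g) :
    IsSmooth (f + g) :=
  ContDiffOn.add hf hg

theorem IsSmooth.mul {f g : unitInterval → ℂ} (hf : IsSmooth f) (hg : IsSmooth g) :
    IsSmooth (f * g) :=
  ContDiffOn.mul hf hg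

theorem IsSmooth.const (c : ℂ) : IsSmooth (fun _ => c) :=
  contDiffOn_const (c := c)

theorem IsSmooth.contDiffWithinAt {f : unitInterval → ℂ} (hf : IsSmooth f) (n : ℕ)
    (x : unitInterval) : ContDiffWithinAt ℝ n (ext f) (Set.Icc 0 1) (x : ℝ) :=
  (ContDiffOn.of_le hf (by exact_mod_cast le_top)) x x.2

theorem supDeriv_add_le {f g : unitInterval → ℂ} (hf : IsSmooth f) (hg : IsSmooth g) (n : ℕ) :
    supDeriv n (f + g) ≤ supDeriv n f + supDeriv n g := by
  refine ciSup_le fun x => ?_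
  have h : nthDeriv n (f + g) x = nthDeriv n f x + nthDeriv n g x :=
    iteratedDerivWithin_add x.2 (uniqueDiffOn_Icc zero_lt_one)
      (hf.contDiffWithinAt n x) (hg.contDiffWithinAt n x)
  rw [h]
  exact (norm_add_le _ _).trans (add_le_add (le_supDeriv hf n x) (le_supDeriv hg n x))

theorem supDeriv_smul (c : ℂ) (f : unitInterval → ℂ) (n : ℕ) :
    supDeriv n (c • f) = ‖c‖ * supDeriv n f := by
  have h : ∀ x, nthDeriv n (c • f) x = c • nthDeriv n f x := fun x =>
    iteratedDerivWithin_const_smul_field c (ext f)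
  simp only [supDeriv, h, norm_smul]
  exact (Real.mul_iSup_of_nonneg (norm_nonneg c) _).symm

theorem supDeriv_mul_le {f g : unitInterval → ℂ} (hf : IsSmooth f) (hg : IsSmooth g) (n : ℕ) :
    supDeriv n (f * g) ≤
      ∑ i ∈ Finset.range (n + 1), (n.choose i : ℝ) * supDeriv i f * supDeriv (n - i) g := by
  refine ciSup_le fun x => ?_
  have h := norm_iteratedFDerivWithin_mul_le (n := n) hf hg (uniqueDiffOn_Icc zero_lt_one) x.2
    (by exact_mod_cast le_top)
  simp only [norm_iteratedFDerivWithin_eq_norm_iteratedDerivWithin] at h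
  refine h.trans (Finset.sum_le_sum fun i _ => ?_)
  have h1 := le_supDeriv hf i x
  have h2 := le_supDeriv hg (n - i) x
  have h3 := supDeriv_nonneg i f
  simp only [nthDeriv] at h1 h2
  gcongr

theorem supDeriv_mul_div_le (M : WeightSequence) {f g : unitInterval → ℂ} (hf : IsSmooth f)
    (hg : IsSmooth g) (n : ℕ) :
    supDeriv n (f * g) / M n ≤
      ∑ i ∈ Finset.range (n + 1), supDeriv i f / M i * (supDeriv (n - i) g / M (n - i)) := by
  rw [div_le_iff₀ (M.pos n), Finset.sum_mul]
  refine (supDeriv_mul_le hf hg n).trans (Finset.sum_le_sum fun i hi => ?_)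
  have hin : i + (n - i) = n := by have := Finset.mem_range.1 hi; omega
  have hc := M.choose_le (n - i) i
  rw [hin] at hc
  have h1 := supDeriv_nonneg i f
  have h2 := supDeriv_nonneg (n - i) g
  calc (n.choose i : ℝ) * supDeriv i f * supDeriv (n - i) g
      = (n.choose i : ℝ) * (supDeriv i f * supDeriv (n - i) g) := by ring
    _ ≤ M n / (M i * M (n - i)) * (supDeriv i f * supDeriv (n - i) g) := by gcongr
    _ = supDeriv i f / M i * (supDeriv (n - i) g / M (n - i)) * M n := by
      have := (M.pos i).ne'
      have := (M.pos (n - i)).ne'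
      field_simp

theorem div_nonneg' (M : WeightSequence) (f : unitInterval → ℂ) (n : ℕ) :
    0 ≤ supDeriv n f / M n :=
  div_nonneg (supDeriv_nonneg n f) (M.pos n).le

theorem MemD.add {M : WeightSequence} {f g : unitInterval → ℂ} (hf : MemD M f) (hg : MemD M g) :
    MemD M (f + g) := by
  refine ⟨hf.1.add hg.1, Summable.of_nonneg_of_le (div_nonneg' M _) (fun n => ?_)
    (hf.2.add hg.2)⟩
  rw [← add_div]
  exact div_le_div_of_nonneg_right (supDeriv_add_le hf.1 hg.1 n) (M.pos n).le

theorem summable_cauchy {M : WeightSequence} {f g : unitInterval → ℂ} (hf : MemD M f)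
    (hg : MemD M g) :
    Summable (fun n => ∑ i ∈ Finset.range (n + 1),
      supDeriv i f / M i * (supDeriv (n - i) g / M (n - i))) :=
  summable_sum_mul_range_of_summable_norm' (f := fun i => supDeriv i f / M i)
    (g := fun i => supDeriv i g / M i) hf.2.norm hf.2 hg.2.norm hg.2

theorem MemD.mul {M : WeightSequence} {f g : unitInterval → ℂ} (hf : MemD M f) (hg : MemD M g) :
    MemD M (f * g) :=
  ⟨hf.1.mul hg.1, Summable.of_nonneg_of_le (div_nonneg' M _)
    (supDeriv_mul_div_le M hf.1 hg.1) (summable_cauchy hf hg)⟩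

theorem MemD.const (M : WeightSequence) (c : ℂ) : MemD M (fun _ => c) := by
  refine ⟨IsSmooth.const c, summable_of_ne_finset_zero (s := {0}) fun n hn => ?_⟩
  have hn' : n ≠ 0 := by simpa using hn
  have h : ∀ x, nthDeriv n (fun _ => c) x = 0 := fun x => by
    have : ext (fun _ : unitInterval => c) = fun _ => c := rfl
    simp [nthDeriv, this, iteratedDerivWithin_const, hn']
  simp [supDeriv, h]

/-- `D([0,1],M)` as a subalgebra of the algebra of all functions `[0,1] → ℂ`. -/
def subalg (M : WeightSequence) : Subalgebra ℂ (unitInterval → ℂ) where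
  carrier := {f | MemD M f}
  mul_mem' hf hg := MemD.mul hf hg
  add_mem' hf hg := MemD.add hf hg
  algebraMap_mem' c := MemD.const M c

/-- The algebra `D([0,1],M)`, as a type of its own: its topology is that of the norm below, not
that of pointwise convergence. -/
def D (M : WeightSequence) : Type := subalg M

namespace D

variable {M : WeightSequence}

instance : CommRing (D M) := inferInstanceAs (CommRing (subalg M))

instance : Algebra ℂ (D M) := inferInstanceAs (Algebra ℂ (subalg M))

instance : CoeFun (D M) (fun _ => unitInterval → ℂ) := ⟨Subtype.val⟩

theorem memD (f : D M) : MemD M f := f.2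

/-- `‖f‖_D = ∑ₙ ‖f⁽ⁿ⁾‖_∞ / Mₙ`. -/
instance : Norm (D M) := ⟨fun f => ∑' n, supDeriv n f / M n⟩

theorem norm_def (f : D M) : ‖f‖ = ∑' n, supDeriv n f / M n := rfl

theorem norm_smul_eq (c : ℂ) (f : D M) : ‖c • f‖ = ‖c‖ * ‖f‖ := by
  rw [norm_def, norm_def, ← tsum_mul_left]
  refine tsum_congr fun n => ?_
  have h : supDeriv n (c • f : D M) = ‖c‖ * supDeriv n f := supDeriv_smul c f n
  rw [h, mul_div_assoc]

theorem norm_add_le' (f g : D M) : ‖f + g‖ ≤ ‖f‖ + ‖g‖ := by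
  rw [norm_def, norm_def, norm_def, ← f.memD.2.tsum_add g.memD.2]
  refine (f + g).memD.2.tsum_le_tsum (fun n => ?_) (f.memD.2.add g.memD.2)
  rw [← add_div]
  exact div_le_div_of_nonneg_right (supDeriv_add_le f.memD.1 g.memD.1 n) (M.pos n).le

theorem norm_mul_le' (f g : D M) : ‖f * g‖ ≤ ‖f‖ * ‖g‖ := by
  rw [norm_def, norm_def, norm_def,
    tsum_mul_tsum_eq_tsum_sum_range_of_summable_norm f.memD.2.norm g.memD.2.norm]
  exact (f * g).memD.2.tsum_le_tsum (supDeriv_mul_div_le M f.memD.1 g.memD.1)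
    (summable_cauchy f.memD g.memD)

theorem norm_apply_le (f : D M) (x : unitInterval) : ‖f x‖ ≤ ‖f‖ := by
  have h0 : nthDeriv 0 f x = f x := by simp [nthDeriv, ext]
  have h1 := le_supDeriv f.memD.1 0 x
  have h2 : supDeriv 0 f / M 0 ≤ ‖f‖ := f.memD.2.le_tsum 0 fun n _ => div_nonneg' M f n
  rw [M.map_zero, div_one] at h2
  rw [← h0]
  exact h1.trans h2

/-- `‖·‖_D` is an additive group norm. -/
def addGroupNorm (M : WeightSequence) : AddGroupNorm (D M) where
  toFun f := ‖f‖
  map_zero' := by simpa using norm_smul_eq (0 : ℂ) (0 : D M)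
  add_le' := norm_add_le'
  neg' f := by simpa using norm_smul_eq (-1 : ℂ) f
  eq_zero_of_map_eq_zero' f hf := by
    refine Subtype.ext (funext fun x => ?_)
    have h := norm_apply_le f x
    rw [hf] at h
    exact norm_le_zero_iff.1 h

instance : NormedCommRing (D M) :=
  { (addGroupNorm M).toNormedAddCommGroup, (inferInstance : CommRing (D M)) with
    toNorm := inferInstance
    norm_mul_le := norm_mul_le' }

instance : NormedAlgebra ℂ (D M) where
  norm_smul_le c f := (norm_smul_eq c f).le

end D

end DalesDavie

end

/-!
If `φ` fixes `c`, then `f ↦ f ∘ φ` maps the ideal `V n` of functions vanishing to order `n` at `c`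
into itself and acts on the line `V n / V (n + 1)` as multiplication by `φ'(c) ^ n`. The `V n` are
closed and strictly decreasing, so by Riesz's lemma a compact composition operator has
`φ'(c) ^ n → 0`, that is `|φ'(c)| < 1`. Since this holds at every fixed point, `φ` has only one. The
same applies to `φ ∘ φ`, whose composition operator is also compact, so `φ` has no points of period
two and all its orbits converge to `c`.

The triangular action puts every `φ'(c) ^ n` in the spectrum, and `0` is there because `D([0,1],M)`
is infinite-dimensional. Conversely, a nonzero spectral value `μ` has an eigenfunction `f`. Either
`f` has a first nonzero derivative at `c`, of order `n` say, and then `μ = φ'(c) ^ n`, or `f` is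
flat at `c`. In that case `f(φ^[k] x) = o(‖μ‖ ^ k)`, as `φ^[k] x → c` geometrically, whereas
`f(φ^[k] x) = μ ^ k f(x)`; so `f = 0`.
-/

namespace DalesDavie

open Filter Set Topology

section VanishingOrder

variable {𝕜 𝔸 E : Type*} [NontriviallyNormedField 𝕜] [NormedRing 𝔸] [NormedAlgebra 𝕜 𝔸]
  [NormedAddCommGroup E] [NormedSpace 𝕜 E] [Module 𝔸 E] [IsBoundedSMul 𝔸 E] [IsScalarTower 𝕜 𝔸 E]
  {s : Set 𝕜} {c : 𝕜} {F : 𝕜 → 𝔸} {G : 𝕜 → E} {m n : ℕ}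

/-- `f` vanishes to order `n` at `c`: all its derivatives within `s` of order less than `n` vanish
at `c`. -/
def VanishesToOrder (n : ℕ) (f : 𝕜 → E) (s : Set 𝕜) (c : 𝕜) : Prop :=
  ∀ k < n, iteratedDerivWithin k f s c = 0

theorem vanishesToOrder_succ :
    VanishesToOrder (n + 1) G s c ↔ G c = 0 ∧ VanishesToOrder n (derivWithin G s) s c := by
  simp only [VanishesToOrder, Nat.forall_lt_succ_left', iteratedDerivWithin_zero,
    iteratedDerivWithin_succ']

theorem VanishesToOrder.smul (hs : UniqueDiffOn 𝕜 s) (hc : c ∈ s)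
    (hF : ContDiffWithinAt 𝕜 (m + n : ℕ) F s c) (hG : ContDiffWithinAt 𝕜 (m + n : ℕ) G s c)
    (hFm : VanishesToOrder m F s c) (hGn : VanishesToOrder n G s c) :
    VanishesToOrder (m + n) (F • G) s c := by
  intro k hk
  have hkmn : ((k : ℕ) : WithTop ℕ∞) ≤ (m + n : ℕ) := by exact_mod_cast hk.le
  rw [iteratedDerivWithin_smul hc hs (hF.of_le hkmn) (hG.of_le hkmn)]
  refine Finset.sum_eq_zero fun i hik => ?_
  obtain hi | hi := lt_or_ge i m
  · rw [hFm i hi, zero_smul, smul_zero]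
  · rw [hGn (k - i) (by grind), smul_zero, smul_zero]

theorem iteratedDerivWithin_smul_of_vanishesToOrder (hs : UniqueDiffOn 𝕜 s) (hc : c ∈ s)
    (hF : ContDiffWithinAt 𝕜 (m + n : ℕ) F s c) (hG : ContDiffWithinAt 𝕜 (m + n : ℕ) G s c)
    (hFm : VanishesToOrder m F s c) (hGn : VanishesToOrder n G s c) :
    iteratedDerivWithin (m + n) (F • G) s c =
      (m + n).choose m • iteratedDerivWithin m F s c • iteratedDerivWithin n G s c := by
  rw [iteratedDerivWithin_smul hc hs hF hG, Finset.sum_eq_single m, Nat.add_sub_cancel_left]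
  · intro i himn him
    obtain hi | hi := him.lt_or_gt
    · rw [hFm i hi, zero_smul, smul_zero]
    · rw [hGn (m + n - i) (by grind), smul_zero, smul_zero]
  · exact fun hm => absurd (Finset.mem_range.2 (by omega)) hm

theorem iteratedDerivWithin_comp_of_vanishesToOrder (hs : UniqueDiffOn 𝕜 s) (hc : c ∈ s)
    {Φ : 𝕜 → 𝕜} (hΦ : ContDiffOn 𝕜 ∞ Φ s) (hΦs : MapsTo Φ s s) (hΦc : Φ c = c)
    (hG : ContDiffOn 𝕜 ∞ G s) (hGn : VanishesToOrder n G s c) :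
    iteratedDerivWithin n (G ∘ Φ) s c =
      derivWithin Φ s c ^ n • iteratedDerivWithin n G s c := by
  induction n using Nat.strong_induction_on generalizing G with
  | _ n ih =>
  obtain _ | n := n
  · simp [hΦc]
  have hG' : ContDiffOn 𝕜 ∞ (derivWithin G s) s := hG.derivWithin hs le_rfl
  have hΦ' : ContDiffOn 𝕜 ∞ (derivWithin Φ s) s := hΦ.derivWithin hs le_rfl
  have hG'n : VanishesToOrder n (derivWithin G s) s c := (vanishesToOrder_succ.1 hGn).2
  have hchain : EqOn (derivWithin (G ∘ Φ) s) (derivWithin Φ s • (derivWithin G s ∘ Φ)) s :=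
    fun x hx => derivWithin.scomp x (hG.differentiableOn (by simp) _ (hΦs hx))
      (hΦ.differentiableOn (by simp) x hx) hΦs
  have hcomp : VanishesToOrder n (derivWithin G s ∘ Φ) s c := fun k hk => by
    rw [ih k (by omega) hG' fun j hj => hG'n j (hj.trans hk), hG'n k hk, smul_zero]
  have hLeibniz := iteratedDerivWithin_smul_of_vanishesToOrder (m := 0) (n := n) hs hc
    (hΦ'.of_le (by exact_mod_cast le_top) c hc)
    ((hG'.comp hΦ hΦs).of_le (by exact_mod_cast le_top) c hc)
    (fun k hk => absurd hk k.not_lt_zero) hcomp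
  rw [zero_add, Nat.choose_zero_right, one_smul, iteratedDerivWithin_zero,
    ih n n.lt_succ_self hG' hG'n] at hLeibniz
  rw [iteratedDerivWithin_succ', iteratedDerivWithin_congr hchain hc, hLeibniz,
    iteratedDerivWithin_succ', pow_succ', mul_smul]

end VanishingOrder

section Triangular

variable {𝕜 X : Type*} [Field 𝕜] [AddCommGroup X] [Module 𝕜 X] {T : Module.End 𝕜 X}
  {E : ℕ → Submodule 𝕜 X} {ν : ℕ → 𝕜}

/-- `T` is triangular with diagonal `ν` along the filtration `E`: it acts on `E n / E (n + 1)` as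
the scalar `ν n`. -/
def IsTriangular (T : Module.End 𝕜 X) (E : ℕ → Submodule 𝕜 X) (ν : ℕ → 𝕜) : Prop :=
  ∀ n, ∀ x ∈ E n, T x - ν n • x ∈ E (n + 1)

namespace IsTriangular

theorem map_mem (hT : IsTriangular T E ν) (hE : Antitone E) {n : ℕ} {x : X} (hx : x ∈ E n) :
    T x ∈ E n :=
  ((E n).sub_mem_iff_left ((E n).smul_mem (ν n) hx)).1 (hE n.le_succ (hT n x hx))

theorem mem_succ_of_sub_smul_mem (hT : IsTriangular T E ν) {n : ℕ} {μ : 𝕜} (hμ : ν n ≠ μ) {x : X}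
    (hx : x ∈ E n) (hTx : T x - μ • x ∈ E (n + 1)) : x ∈ E (n + 1) := by
  have h : (ν n - μ) • x ∈ E (n + 1) := by
    convert (E (n + 1)).sub_mem hTx (hT n x hx) using 1
    module
  exact ((E (n + 1)).smul_mem_iff (sub_ne_zero.2 hμ)).1 h

theorem exists_eq_of_apply_eq_smul (hT : IsTriangular T E ν) (hE0 : E 0 = ⊤) {μ : 𝕜} {x : X}
    (hx : T x = μ • x) {N : ℕ} (hxN : x ∉ E N) : ∃ n, μ = ν n := by
  by_contra! hμ
  refine hxN (Nat.rec (hE0 ▸ Submodule.mem_top) (fun n hn => ?_) N)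
  exact hT.mem_succ_of_sub_smul_mem (hμ n).symm hn (by simp [hx])

theorem not_surjective (hT : IsTriangular T E ν) (hE : StrictAnti E) (hE0 : E 0 = ⊤) (n : ℕ) :
    ¬ Function.Surjective (T - ν n • 1 : Module.End 𝕜 X) := by
  induction n using Nat.strong_induction_on with
  | _ n ih =>
  intro hsurj
  have hν : ∀ k < n, ν k ≠ ν n := fun k hk hkn => ih k hk (hkn ▸ hsurj)
  obtain ⟨x, hxn, hxn'⟩ := SetLike.exists_of_lt (hE n.lt_succ_self)
  obtain ⟨y, rfl⟩ := hsurj x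
  have hy : ∀ k ≤ n, y ∈ E k := by
    intro k hk
    induction k with
    | zero => exact hE0 ▸ Submodule.mem_top
    | succ k ihk =>
      exact hT.mem_succ_of_sub_smul_mem (hν k hk) (ihk (Nat.le_of_succ_le hk))
        (by simpa using hE.antitone hk hxn)
  exact hxn' (by simpa using hT n y (hy n le_rfl))

end IsTriangular

end Triangular

section Compact

variable {𝕜 X : Type*} [NontriviallyNormedField 𝕜] [NormedAddCommGroup X] [NormedSpace 𝕜 X]
  {T : X →L[𝕜] X}

theorem exists_seq_norm_le_one_le_norm_sub {E : ℕ → Submodule 𝕜 X}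
    (hE : StrictAnti E) (hclosed : ∀ n, IsClosed (E n : Set X)) :
    ∃ (R : ℝ) (x : ℕ → X), (∀ n, x n ∈ E n) ∧ (∀ n, ‖x n‖ ≤ R) ∧
      ∀ n, ∀ y ∈ E (n + 1), 1 ≤ ‖x n - y‖ := by
  obtain ⟨a, ha⟩ := NormedField.exists_one_lt_norm 𝕜
  have hriesz (n : ℕ) : ∃ x ∈ E n, ‖x‖ ≤ ‖a‖ + 1 ∧ ∀ y ∈ E (n + 1), 1 ≤ ‖x - y‖ := by
    have hF : IsClosed ((E (n + 1)).comap (E n).subtype : Set (E n)) :=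
      (hclosed (n + 1)).preimage continuous_subtype_val
    obtain ⟨z, hz, hz'⟩ := SetLike.exists_of_lt (hE n.lt_succ_self)
    obtain ⟨x, hxR, hx⟩ := riesz_lemma_of_norm_lt ha (lt_add_one ‖a‖) hF ⟨⟨z, hz⟩, hz'⟩
    exact ⟨x, x.2, hxR, fun y hy => hx ⟨y, hE.antitone n.le_succ hy⟩ hy⟩
  choose x hxE hxR hx using hriesz
  exact ⟨‖a‖ + 1, x, hxE, hxR, hx⟩

theorem IsTriangular.tendsto_zero_of_isCompactOperator {E : ℕ → Submodule 𝕜 X} {ν : ℕ → 𝕜}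
    (hTE : IsTriangular (T : Module.End 𝕜 X) E ν) (hT : IsCompactOperator T) (hE : StrictAnti E)
    (hclosed : ∀ n, IsClosed (E n : Set X)) : Tendsto ν atTop (𝓝 0) := by
  obtain ⟨R, x, hxE, hxR, hx⟩ := exists_seq_norm_le_one_le_norm_sub hE hclosed
  have hsep {n m : ℕ} (hnm : n < m) : ‖ν n‖ ≤ ‖T (x n) - T (x m)‖ := by
    obtain hν | hν := eq_or_ne (ν n) 0
    · simp [hν]
    have hmem : T (x m) - (T (x n) - ν n • x n) ∈ E (n + 1) :=
      (E (n + 1)).sub_mem (hE.antitone hnm (hTE.map_mem hE.antitone (hxE m))) (hTE n _ (hxE n))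
    have hdecomp : T (x n) - T (x m) =
        ν n • (x n - (ν n)⁻¹ • (T (x m) - (T (x n) - ν n • x n))) := by
      rw [smul_sub, smul_inv_smul₀ hν]
      abel
    rw [hdecomp, norm_smul]
    exact le_mul_of_one_le_right (norm_nonneg _) (hx n _ ((E (n + 1)).smul_mem _ hmem))
  obtain ⟨K, hK, hKT⟩ := hT.image_closedBall_subset_compact R
  by_contra hν
  obtain ⟨ε, hε, hfreq⟩ : ∃ ε > 0, ∃ᶠ n in atTop, ε ≤ ‖ν n‖ := by
    simpa [Metric.tendsto_nhds, Filter.Frequently] using hν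
  obtain ⟨k, hk, hkε⟩ := extraction_of_frequently_atTop hfreq
  obtain ⟨_, -, l, hl, hlim⟩ := hK.tendsto_subseq (x := fun n => T (x (k n))) fun n =>
    hKT ⟨x (k n), by simpa using hxR (k n), rfl⟩
  obtain ⟨N, hN⟩ := Metric.cauchySeq_iff.1 hlim.cauchySeq ε hε
  have hdist := hN N le_rfl (N + 1) N.le_succ
  rw [dist_eq_norm] at hdist
  exact ((hkε (l N)).trans (hsep (hk (hl N.lt_succ_self)))).not_gt hdist

/- `D([0,1],M)` need not be complete, so the Fredholm alternative cannot rely on the open mapping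
theorem: compactness of `T` takes its place. -/
theorem isClosedMap_sub_smul_one (hT : IsCompactOperator T) {μ : 𝕜} (hμ : μ ≠ 0) {K : NNReal}
    (hK : AntilipschitzWith K (T - μ • 1 : X →L[𝕜] X)) :
    IsClosedMap (T - μ • 1 : X →L[𝕜] X) := by
  intro C hC
  refine IsSeqClosed.isClosed fun u y hu hy => ?_
  choose x hxC hx using hu
  obtain ⟨R, hR⟩ : ∃ R, ∀ n, ‖x n‖ ≤ R := by
    obtain ⟨R, hR⟩ := hy.norm.bddAbove_range
    refine ⟨K * R, fun n => (hK.le_mul_norm (map_zero _) (x n)).trans ?_⟩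
    rw [hx n]
    exact mul_le_mul_of_nonneg_left (hR ⟨n, rfl⟩) K.2
  obtain ⟨S, hS, hST⟩ := hT.image_closedBall_subset_compact R
  obtain ⟨z, -, k, hk, hz⟩ := hS.tendsto_subseq (x := fun n => T (x n)) fun n =>
    hST ⟨x n, by simpa using hR n, rfl⟩
  have hyk : Tendsto (fun n => u (k n)) atTop (𝓝 y) := hy.comp hk.tendsto_atTop
  have hxk : Tendsto (fun n => x (k n)) atTop (𝓝 (μ⁻¹ • (z - y))) := by
    refine ((hz.sub hyk).const_smul μ⁻¹).congr fun n => ?_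
    simp [← hx, hμ]
  refine ⟨_, hC.mem_of_tendsto hxk (Eventually.of_forall fun n => hxC _), ?_⟩
  exact tendsto_nhds_unique (((T - μ • 1 : X →L[𝕜] X).continuous.tendsto _).comp hxk)
    (hyk.congr fun n => (hx (k n)).symm)

theorem surjective_sub_smul_one (hT : IsCompactOperator T) {μ : 𝕜} (hμ : μ ≠ 0) {K : NNReal}
    (hK : AntilipschitzWith K (T - μ • 1 : X →L[𝕜] X)) :
    Function.Surjective (T - μ • 1 : X →L[𝕜] X) := by
  set S : X →L[𝕜] X := T - μ • 1 with hS
  by_contra hsurj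
  let E : ℕ → Submodule 𝕜 X := fun n => LinearMap.range ((S : Module.End 𝕜 X) ^ n)
  have hE_zero : E 0 = ⊤ := LinearMap.range_id
  have hE_succ (n : ℕ) : E (n + 1) = (E n).map (S : Module.End 𝕜 X) := by
    simp only [E, pow_succ', Module.End.mul_eq_comp, LinearMap.range_comp]
  have hE : StrictAnti E := strictAnti_nat_of_succ_lt fun n => by
    induction n with
    | zero =>
      rw [hE_succ, hE_zero, Submodule.map_top, lt_top_iff_ne_top, Ne, LinearMap.range_eq_top]
      exact hsurj
    | succ n ih =>
      rw [hE_succ (n + 1)]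
      exact (Submodule.map_strictMono_of_injective hK.injective ih).trans_eq (hE_succ n).symm
  have hclosed (n : ℕ) : IsClosed (E n : Set X) := by
    induction n with
    | zero => simp [hE_zero]
    | succ n ih => exact hE_succ n ▸ isClosedMap_sub_smul_one hT hμ hK _ ih
  have htri : IsTriangular (T : Module.End 𝕜 X) E fun _ => μ := fun n x hx => by
    rw [hE_succ]
    exact ⟨x, hx, by simp [hS]⟩
  exact hμ (tendsto_nhds_unique tendsto_const_nhds
    (htri.tendsto_zero_of_isCompactOperator hT hE hclosed))

theorem hasEigenvalue_of_mem_spectrum (hT : IsCompactOperator T) {μ : 𝕜} (hμ : μ ≠ 0)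
    (hσ : μ ∈ spectrum 𝕜 T) : Module.End.HasEigenvalue (T : Module.End 𝕜 X) μ := by
  by_contra hne
  obtain ⟨K, hK⟩ := hT.antilipschitz_of_not_hasEigenvalue hμ hne
  have hsurj := surjective_sub_smul_one hT hμ hK
  let e : X ≃ₗ[𝕜] X :=
    LinearEquiv.ofBijective ((T - μ • 1 : X →L[𝕜] X) : X →ₗ[𝕜] X) ⟨hK.injective, hsurj⟩
  have hcont : Continuous e.symm := (hK.to_rightInverse e.apply_symm_apply).continuous
  have hunit : IsUnit (T - μ • 1 : X →L[𝕜] X) :=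
    (ContinuousLinearEquiv.toUnit ⟨e, (T - μ • 1 : X →L[𝕜] X).continuous, hcont⟩).isUnit
  rw [spectrum.mem_iff, Algebra.algebraMap_eq_smul_one, IsUnit.sub_iff] at hσ
  exact hσ hunit

theorem zero_mem_spectrum_of_isCompactOperator [CompleteSpace 𝕜] (hT : IsCompactOperator T)
    (hX : ¬ FiniteDimensional 𝕜 X) : (0 : 𝕜) ∈ spectrum 𝕜 T := by
  rw [spectrum.zero_mem_iff]
  rintro ⟨u, rfl⟩
  have hid : ((↑u⁻¹ : X →L[𝕜] X) ∘ (u : X →L[𝕜] X) : X → X) = id :=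
    congrArg (fun S : X →L[𝕜] X => (S : X → X)) u.inv_mul
  exact hX (FiniteDimensional.of_isCompactOperator_id (hid ▸ hT.clm_comp (↑u⁻¹ : X →L[𝕜] X)))

theorem IsTriangular.mem_spectrum {E : ℕ → Submodule 𝕜 X} {ν : ℕ → 𝕜}
    (hTE : IsTriangular (T : Module.End 𝕜 X) E ν) (hE : StrictAnti E) (hE0 : E 0 = ⊤) (n : ℕ) :
    ν n ∈ spectrum 𝕜 T := by
  rw [spectrum.mem_iff, Algebra.algebraMap_eq_smul_one, IsUnit.sub_iff]
  rintro ⟨u, hu⟩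
  refine hTE.not_surjective hE hE0 n fun y => ⟨(↑u⁻¹ : X →L[𝕜] X) y, ?_⟩
  have hy : (u : X →L[𝕜] X) ((↑u⁻¹ : X →L[𝕜] X) y) = y :=
    congrArg (fun S : X →L[𝕜] X => S y) u.mul_inv
  rwa [hu] at hy

theorem IsTriangular.spectrum_eq [CompleteSpace 𝕜] {E : ℕ → Submodule 𝕜 X} {ν : ℕ → 𝕜}
    (hTE : IsTriangular (T : Module.End 𝕜 X) E ν) (hT : IsCompactOperator T) (hE : StrictAnti E)
    (hE0 : E 0 = ⊤) (hflat : ∀ μ : 𝕜, μ ≠ 0 → ∀ x, T x = μ • x → (∀ n, x ∈ E n) → x = 0) :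
    spectrum 𝕜 T = insert 0 (range ν) := by
  refine Subset.antisymm (fun μ hμ => ?_) (insert_subset ?_ ?_)
  · refine or_iff_not_imp_left.2 fun hμ0 => ?_
    obtain ⟨x, hx, hx0⟩ := (hasEigenvalue_of_mem_spectrum hT hμ0 hμ).exists_hasEigenvector
    rw [Module.End.mem_eigenspace_iff] at hx
    obtain ⟨N, hN⟩ : ∃ N, x ∉ E N := by
      contrapose! hx0
      exact hflat μ hμ0 x hx hx0
    obtain ⟨n, rfl⟩ := hTE.exists_eq_of_apply_eq_smul hE0 hx hN
    exact mem_range_self n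
  · exact zero_mem_spectrum_of_isCompactOperator hT fun _ => not_strictAnti_of_wellFoundedLT E hE
  · exact range_subset_iff.2 (hTE.mem_spectrum hE hE0)

end Compact

section Dynamics

theorem exists_mapClusterPt_apply_eq {ι X Y : Type*} [TopologicalSpace X] [CompactSpace X]
    [TopologicalSpace Y] [T2Space Y] {φ : X → Y} (hφ : Continuous φ) {l : Filter ι} {u : ι → X}
    {z : Y} (hz : MapClusterPt z l (φ ∘ u)) : ∃ y, MapClusterPt y l u ∧ φ y = z := by
  obtain ⟨U, hUl, hUz⟩ := mapClusterPt_iff_ultrafilter.1 hz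
  have hUy : Tendsto u U (𝓝 (U.map u).lim) := (U.map u).le_nhds_lim
  exact ⟨_, mapClusterPt_iff_ultrafilter.2 ⟨U, hUl, hUy⟩,
    tendsto_nhds_unique ((hφ.tendsto _).comp hUy) hUz⟩

theorem mapClusterPt_iterate_subset_image {X : Type*} [TopologicalSpace X] [CompactSpace X]
    [T2Space X] {φ : X → X} (hφ : Continuous φ) (x : X) :
    {z | MapClusterPt z atTop fun n => φ^[n] x} ⊆
      φ '' {z | MapClusterPt z atTop fun n => φ^[n] x} := by
  intro z hz
  have hshift : map (fun n => φ^[n] x) atTop = map (φ ∘ fun n => φ^[n] x) atTop := by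
    rw [← Filter.map_add_atTop_eq_nat 1, map_map, map_add_atTop_eq_nat 1]
    simp only [Function.comp_def, Function.iterate_succ_apply']
  exact exists_mapClusterPt_apply_eq hφ (by rwa [MapClusterPt, ← hshift])

variable {α : Type*} [CompleteLinearOrder α] [TopologicalSpace α] [OrderTopology α]
  [DenselyOrdered α] {φ : α → α} {c : α}

theorem exists_apply_eq_self (hφ : Continuous φ) : ∃ x, φ x = x :=
  let ⟨x, _, hx⟩ := exists_mem_Icc_isFixedPt hφ.continuousOn bot_le bot_le le_top
  ⟨x, hx⟩

theorem lt_apply_of_lt (hφ : Continuous φ) (hc : ∀ y, φ y = y → y = c) {x : α} (hx : x < c) :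
    x < φ x := by
  by_contra! hle
  obtain ⟨y, hy, hφy⟩ := exists_mem_Icc_isFixedPt hφ.continuousOn bot_le bot_le hle
  exact (hy.2.trans_lt hx).ne (hc y hφy)

theorem apply_lt_of_lt (hφ : Continuous φ) (hc : ∀ y, φ y = y → y = c) {x : α} (hx : c < x) :
    φ x < x :=
  lt_apply_of_lt (α := αᵒᵈ) hφ hc hx

/- If `φ p < c` is the least point of `K` and `φ q` the greatest, then `p > c > q`, so some `y`
between `q` and `c` is sent to `p`, and `φ (φ y) = φ p ≤ q ≤ y < c`. But `φ ∘ φ` moves the points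
below `c` upwards. -/
theorem le_of_mem_of_subset_image (hφ : Continuous φ) (hc : ∀ y, φ (φ y) = y → y = c)
    {K : Set α} (hK : IsCompact K) (hφK : K ⊆ φ '' K) {x : α} (hx : x ∈ K) : c ≤ x := by
  have hc₁ (y : α) (hy : φ y = y) : y = c := hc y (by rw [hy, hy])
  have hcc : φ c = c := by
    obtain ⟨y, hy⟩ := exists_apply_eq_self hφ
    rwa [hc₁ y hy] at hy
  obtain ⟨a, haK, ha⟩ := hK.exists_isLeast ⟨x, hx⟩
  obtain ⟨b, hbK, hb⟩ := hK.exists_isGreatest ⟨x, hx⟩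
  by_contra! hxc
  have hac : a < c := (ha hx).trans_lt hxc
  obtain ⟨p, hpK, rfl⟩ := hφK haK
  obtain ⟨q, hqK, rfl⟩ := hφK hbK
  have hcp : c < p := by
    by_contra! hpc
    obtain rfl | hpc := hpc.eq_or_lt
    · exact hac.ne hcc
    · exact (lt_apply_of_lt hφ hc₁ hpc).not_ge (ha hpK)
  have hqc : q < c := by
    by_contra! hcq
    obtain rfl | hcq := hcq.eq_or_lt
    · exact (hcp.trans_le (hb hpK)).ne hcc.symm
    · exact (apply_lt_of_lt hφ hc₁ hcq).not_ge (hb hqK)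
  obtain ⟨y, hy, rfl⟩ := intermediate_value_Icc' hqc.le hφ.continuousOn
    (show p ∈ Icc (φ c) (φ q) from ⟨hcc.trans_le hcp.le, hb hpK⟩)
  have hyc : y < c := hy.2.lt_of_ne fun h => hcp.ne (by rw [h, hcc])
  exact ((ha hqK).trans hy.1).not_gt (lt_apply_of_lt (hφ.comp hφ) hc hyc)

theorem tendsto_iterate_of_unique_fixed_point_comp_self (hφ : Continuous φ)
    (hc : ∀ y, φ (φ y) = y → y = c) (x : α) : Tendsto (fun n => φ^[n] x) atTop (𝓝 c) := by
  set K : Set α := {z | MapClusterPt z atTop fun n => φ^[n] x}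
  have hK : IsCompact K := isClosed_setOfPred_clusterPt.isCompact
  have hφK : K ⊆ φ '' K := mapClusterPt_iterate_subset_image hφ x
  exact tendsto_nhds_of_unique_mapClusterPt fun z hz => le_antisymm
    (le_of_mem_of_subset_image (α := αᵒᵈ) hφ hc hK hφK hz)
    (le_of_mem_of_subset_image hφ hc hK hφK hz)

theorem apply_eq_zero_of_isBigO_dist_pow {𝕜 E X : Type*} [NormedField 𝕜] [NormedAddCommGroup E]
    [NormedSpace 𝕜 E] [PseudoMetricSpace X] {φ : X → X} {c x : X} {f : X → E} {μ : 𝕜} {ρ : ℝ}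
    {N : ℕ} (hμ : ∀ y, f (φ y) = μ • f y) (hρ₀ : 0 ≤ ρ)
    (hρ : ∀ᶠ y in 𝓝 c, dist (φ y) c ≤ ρ * dist y c) (hf : f =O[𝓝 c] fun y => dist y c ^ N)
    (hρμ : ρ ^ N < ‖μ‖) (hx : Tendsto (fun n => φ^[n] x) atTop (𝓝 c)) : f x = 0 := by
  have hμ₀ : 0 < ‖μ‖ := (pow_nonneg hρ₀ N).trans_lt hρμ
  set v : ℕ → ℝ := fun n => dist (φ^[n] x) c ^ N / ‖μ‖ ^ n with hv
  have hv_ratio : ∀ᶠ n in atTop, ‖v (n + 1)‖ ≤ ρ ^ N / ‖μ‖ * ‖v n‖ := by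
    filter_upwards [hx.eventually hρ] with n hn
    have hpow := pow_le_pow_left₀ dist_nonneg hn N
    rw [mul_pow] at hpow
    rw [Real.norm_of_nonneg (by positivity), Real.norm_of_nonneg (by positivity)]
    simp only [hv, Function.iterate_succ_apply', pow_succ, div_mul_div_comm]
    rw [mul_comm ‖μ‖]
    gcongr
  have hv_lim : Tendsto v atTop (𝓝 0) :=
    (summable_of_ratio_norm_eventually_le ((div_lt_one hμ₀).2 hρμ) hv_ratio).tendsto_atTop_zero
  have hiter (n : ℕ) : f (φ^[n] x) = μ ^ n • f x := by
    induction n with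
    | zero => simp
    | succ n ih => rw [Function.iterate_succ_apply', hμ, ih, smul_smul, pow_succ']
  obtain ⟨C, hC⟩ := hf.bound
  refine norm_le_zero_iff.1 (ge_of_tendsto (by simpa using hv_lim.const_mul C) ?_)
  filter_upwards [hx.eventually hC] with n hn
  rw [hiter, norm_smul, norm_pow, Real.norm_of_nonneg (by positivity)] at hn
  rwa [hv, ← mul_div_assoc, le_div_iff₀' (by positivity)]

theorem eq_of_apply_eq_self_of_deriv_lt_one {s : Set ℝ} (hs : s.OrdConnected) {f f' : ℝ → ℝ}
    (hf : ∀ x ∈ s, HasDerivWithinAt f (f' x) s x) (hf' : ∀ x ∈ s, f x = x → f' x < 1) {a b : ℝ}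
    (has : a ∈ s) (hbs : b ∈ s) (ha : f a = a) (hb : f b = b) : a = b := by
  by_contra hne
  wlog hab : a < b generalizing a b
  · exact this hbs has hb ha (Ne.symm hne) (lt_of_le_of_ne (not_lt.1 hab) (Ne.symm hne))
  have hIcc : Icc a b ⊆ s := hs.out has hbs
  have hle : ∀ ⦃x⦄, x ∈ Icc a b → f x ≤ x :=
    image_le_of_deriv_right_lt_deriv_boundary' (f' := f') (B' := fun _ => 1)
      (fun x hx => ((hf x (hIcc hx)).mono hIcc).continuousWithinAt)
      (fun x hx => (hf x (hIcc (Ico_subset_Icc_self hx))).mono_of_mem_nhdsWithin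
        (mem_of_superset (Icc_mem_nhdsGE_of_mem hx) hIcc))
      ha.le continuousOn_id (fun x _ => hasDerivWithinAt_id x _)
      (fun x hx => hf' x (hIcc (Ico_subset_Icc_self hx)))
  have hslope : ∀ᶠ x in 𝓝[<] b, slope f b x < 1 :=
    ((hf b hbs).mono_of_mem_nhdsWithin
      (mem_of_superset (Icc_mem_nhdsLT hab) hIcc)).limsup_slope_le' (lt_irrefl b) (hf' b hbs hb)
  obtain ⟨x, hx, hxa, hxb⟩ := (hslope.and (Ioo_mem_nhdsLT hab)).exists
  rw [slope_def_field, div_lt_one_of_neg (sub_neg.2 hxb), hb] at hx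
  linarith [hle ⟨hxa.le, hxb.le⟩]

end Dynamics

section Coordinate

theorem ext_apply {E : Type*} (f : unitInterval → E) {t : ℝ} (ht : t ∈ Icc (0 : ℝ) 1) :
    ext f t = f ⟨t, ht⟩ :=
  IccExtend_of_mem _ _ ht

theorem nthDeriv_zero (f : unitInterval → ℂ) (x : unitInterval) : nthDeriv 0 f x = f x := by
  rw [nthDeriv, iteratedDerivWithin_zero, ext_apply f x.2]

theorem isSmooth_coe_sub (c : ℂ) : IsSmooth fun x : unitInterval => ((x : ℝ) : ℂ) - c :=
  (Complex.ofRealCLM.contDiff.sub contDiff_const).contDiffOn.congr fun _ ht => ext_apply _ ht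

theorem nthDeriv_succ_coe_sub (c : ℂ) (n : ℕ) (x : unitInterval) :
    nthDeriv (n + 1) (fun x : unitInterval => ((x : ℝ) : ℂ) - c) x = if n = 0 then 1 else 0 := by
  have hderiv : EqOn (derivWithin (ext fun x : unitInterval => ((x : ℝ) : ℂ) - c) (Icc 0 1))
      (fun _ => 1) (Icc 0 1) := fun t ht =>
    ((Complex.ofRealCLM.hasDerivAt.sub_const c).hasDerivWithinAt.congr
      (fun _ hy => ext_apply _ hy) (ext_apply _ ht)).derivWithin
      (uniqueDiffOn_Icc zero_lt_one t ht)
  rw [nthDeriv, iteratedDerivWithin_succ', iteratedDerivWithin_congr hderiv x.2,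
    iteratedDerivWithin_const]

theorem memD_coe_sub (M : WeightSequence) (c : ℂ) :
    MemD M fun x : unitInterval => ((x : ℝ) : ℂ) - c := by
  refine ⟨isSmooth_coe_sub c, summable_of_ne_finset_zero (s := Finset.range 2) fun n hn => ?_⟩
  obtain ⟨n, rfl⟩ : ∃ k, n = k + 2 := ⟨n - 2, by grind⟩
  simp [supDeriv, nthDeriv_succ_coe_sub]

end Coordinate

namespace D

variable {M : WeightSequence} {c : unitInterval} {m n : ℕ} {f g : D M}

/-- The function `x ↦ x - c` as an element of `D([0,1],M)`. -/
noncomputable def coeSub (M : WeightSequence) (c : ℂ) : D M :=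
  ⟨fun x => ((x : ℝ) : ℂ) - c, memD_coe_sub M c⟩

/-- The functional `f ↦ f⁽ⁿ⁾(c)` on `D([0,1],M)`. -/
noncomputable def derivAt (M : WeightSequence) (c : unitInterval) (n : ℕ) : D M →L[ℂ] ℂ :=
  LinearMap.mkContinuous
    { toFun := fun f => nthDeriv n f c
      map_add' := fun f g => iteratedDerivWithin_add c.2 (uniqueDiffOn_Icc zero_lt_one)
        (f.memD.1.contDiffWithinAt n c) (g.memD.1.contDiffWithinAt n c)
      map_smul' := fun z f => iteratedDerivWithin_const_smul_field z (ext f) }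
    (M n) fun f => by
      have hn : supDeriv n f / M n ≤ ‖f‖ := f.memD.2.le_tsum n fun k _ => div_nonneg' M f k
      exact (le_supDeriv f.memD.1 n c).trans ((div_le_iff₀' (M.pos n)).1 hn)

/-- The ideal of all `f ∈ D([0,1],M)` that vanish to order `n` at `c`, as a subspace. -/
noncomputable def vanishing (M : WeightSequence) (c : unitInterval) (n : ℕ) : Submodule ℂ (D M) :=
  ⨅ k : Fin n, LinearMap.ker (derivAt M c k : D M →ₗ[ℂ] ℂ)

theorem mem_vanishing_iff : f ∈ vanishing M c n ↔ ∀ k < n, derivAt M c k f = 0 := by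
  simp only [vanishing, Submodule.mem_iInf, LinearMap.mem_ker]
  exact Fin.forall_iff

theorem isClosed_vanishing (M : WeightSequence) (c : unitInterval) (n : ℕ) :
    IsClosed (vanishing M c n : Set (D M)) := by
  simp only [vanishing, Submodule.coe_iInf]
  exact isClosed_iInter fun k => (derivAt M c k).isClosed_ker

theorem vanishing_zero (M : WeightSequence) (c : unitInterval) : vanishing M c 0 = ⊤ :=
  iInf_of_empty _

theorem mem_vanishing_succ_iff :
    f ∈ vanishing M c (n + 1) ↔ f ∈ vanishing M c n ∧ derivAt M c n f = 0 := by
  simp only [mem_vanishing_iff, Nat.forall_lt_succ_right]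

theorem mul_mem_vanishing (hf : f ∈ vanishing M c m) (hg : g ∈ vanishing M c n) :
    f * g ∈ vanishing M c (m + n) :=
  mem_vanishing_iff.2 <| VanishesToOrder.smul (uniqueDiffOn_Icc zero_lt_one) c.2
    (f.memD.1.contDiffWithinAt _ c) (g.memD.1.contDiffWithinAt _ c) (mem_vanishing_iff.1 hf)
    (mem_vanishing_iff.1 hg)

theorem derivAt_mul (hf : f ∈ vanishing M c m) (hg : g ∈ vanishing M c n) :
    derivAt M c (m + n) (f * g) = (m + n).choose m • (derivAt M c m f * derivAt M c n g) :=
  iteratedDerivWithin_smul_of_vanishesToOrder (uniqueDiffOn_Icc zero_lt_one) c.2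
    (f.memD.1.contDiffWithinAt _ c) (g.memD.1.contDiffWithinAt _ c) (mem_vanishing_iff.1 hf)
    (mem_vanishing_iff.1 hg)

theorem derivAt_zero_apply (f : D M) : derivAt M c 0 f = f c := nthDeriv_zero f c

theorem coeSub_mem_vanishing (M : WeightSequence) (c : unitInterval) :
    coeSub M c ∈ vanishing M c 1 := by
  rw [mem_vanishing_succ_iff, derivAt_zero_apply, vanishing_zero]
  exact ⟨Submodule.mem_top, sub_self _⟩

theorem coeSub_pow_mem_vanishing (M : WeightSequence) (c : unitInterval) (n : ℕ) :
    coeSub M c ^ n ∈ vanishing M c n := by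
  induction n with
  | zero => simp [vanishing_zero]
  | succ n ih =>
    rw [pow_succ]
    exact mul_mem_vanishing ih (coeSub_mem_vanishing M c)

theorem derivAt_coeSub_pow_ne_zero (M : WeightSequence) (c : unitInterval) (n : ℕ) :
    derivAt M c n (coeSub M c ^ n) ≠ 0 := by
  induction n with
  | zero =>
    rw [derivAt_zero_apply]
    exact one_ne_zero
  | succ n ih =>
    have h1 : derivAt M c 1 (coeSub M c) = 1 := nthDeriv_succ_coe_sub c 0 c
    rw [pow_succ, derivAt_mul (coeSub_pow_mem_vanishing M c n) (coeSub_mem_vanishing M c), h1]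
    simpa [ih] using n.cast_add_one_ne_zero

theorem strictAnti_vanishing (M : WeightSequence) (c : unitInterval) :
    StrictAnti (vanishing M c) :=
  strictAnti_nat_of_succ_lt fun n => SetLike.lt_iff_le_and_exists.2
    ⟨fun _ hf => (mem_vanishing_succ_iff.1 hf).1, coeSub M c ^ n, coeSub_pow_mem_vanishing M c n,
      fun h => derivAt_coeSub_pow_ne_zero M c n (mem_vanishing_succ_iff.1 h).2⟩

theorem tendsto_coe_nhdsWithin_Icc (c : unitInterval) :
    Tendsto ((↑) : unitInterval → ℝ) (𝓝 c) (𝓝[Icc 0 1] (c : ℝ)) :=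
  tendsto_nhdsWithin_iff.2 ⟨continuous_subtype_val.continuousAt, Eventually.of_forall Subtype.prop⟩

theorem isBigO_dist_pow_of_mem_vanishing (hf : f ∈ vanishing M c (n + 1)) :
    f =O[𝓝 c] fun x => dist x c ^ n := by
  have htaylor (t : ℝ) : taylorWithinEval (ext f) n (Icc 0 1) c t = 0 := by
    rw [taylor_within_apply]
    refine Finset.sum_eq_zero fun k hk => ?_
    rw [show iteratedDerivWithin k (ext f) (Icc 0 1) c = 0 from
      mem_vanishing_iff.1 hf k (Finset.mem_range.1 hk), smul_zero]
  have hsmooth : ContDiffOn ℝ n (ext f) (Icc 0 1) := f.memD.1.of_le (by exact_mod_cast le_top)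
  have hO := ((taylor_isLittleO (convex_Icc 0 1) c.2 hsmooth).comp_tendsto
    (tendsto_coe_nhdsWithin_Icc c)).isBigO
  simp only [htaylor, sub_zero, Function.comp_def] at hO
  refine (hO.congr_left fun x => ext_apply _ x.2).trans (Asymptotics.IsBigO.of_norm_le fun x => ?_)
  rw [norm_pow, Subtype.dist_eq, Real.dist_eq, Real.norm_eq_abs]

end D

/-- `T` is the operator `f ↦ f ∘ φ` on `D([0,1],M)`. -/
def IsCompositionOperator {M : WeightSequence} (T : D M →L[ℂ] D M)
    (φ : unitInterval → unitInterval) : Prop :=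
  ∀ (f : D M) (x : unitInterval), T f x = f (φ x)

namespace IsCompositionOperator

open D

variable {M : WeightSequence} {T : D M →L[ℂ] D M} {φ : unitInterval → unitInterval}
  {c : unitInterval} {f : D M} {n : ℕ}

theorem comp_self (hφ : IsCompositionOperator T φ) : IsCompositionOperator (T ∘L T) (φ ∘ φ) :=
  fun f x => (hφ (T f) x).trans (hφ f (φ x))

theorem contDiffOn (hφ : IsCompositionOperator T φ) :
    ContDiffOn ℝ ∞ (ext fun t => (φ t : ℝ)) (Icc 0 1) := by
  refine (Complex.reCLM.contDiff.comp_contDiffOn (T (coeSub M 0)).memD.1).congr fun t ht => ?_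
  rw [Function.comp_apply, ext_apply _ ht, ext_apply _ ht, hφ]
  simp [coeSub]

theorem continuous (hφ : IsCompositionOperator T φ) : Continuous φ :=
  continuous_induced_rng.2 <|
    (continuousOn_iff_continuous_domRestrict.1 hφ.contDiffOn.continuousOn).congr fun x =>
      ext_apply _ x.2

theorem hasDerivWithinAt (hφ : IsCompositionOperator T φ) (x : unitInterval) :
    HasDerivWithinAt (ext fun t => (φ t : ℝ)) (selfMapDeriv φ x) (Icc 0 1) x :=
  (hφ.contDiffOn.differentiableOn (by simp) x x.2).hasDerivWithinAt

theorem derivAt_apply (hφ : IsCompositionOperator T φ) (hc : φ c = c)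
    (hf : f ∈ vanishing M c n) :
    derivAt M c n (T f) = (selfMapDeriv φ c : ℂ) ^ n * derivAt M c n f := by
  have hmaps : MapsTo (ext fun t => (φ t : ℝ)) (Icc 0 1) (Icc 0 1) := fun t ht => by
    rw [ext_apply _ ht]
    exact (φ ⟨t, ht⟩).2
  have hcomp : EqOn (ext (T f)) (ext f ∘ ext fun t => (φ t : ℝ)) (Icc 0 1) := fun t ht => by
    rw [Function.comp_apply, ext_apply _ (hmaps ht), ext_apply _ ht, hφ]
    exact congrArg f (Subtype.ext (ext_apply (fun t => (φ t : ℝ)) ht).symm)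
  have hfix : ext (fun t => (φ t : ℝ)) c = c := by rw [ext_apply _ c.2, hc]
  have h := iteratedDerivWithin_comp_of_vanishesToOrder (uniqueDiffOn_Icc zero_lt_one) c.2
    hφ.contDiffOn hmaps hfix f.memD.1 (mem_vanishing_iff.1 hf)
  rw [← iteratedDerivWithin_congr hcomp c.2, Complex.real_smul, Complex.ofReal_pow] at h
  exact h

theorem isTriangular (hφ : IsCompositionOperator T φ) (hc : φ c = c) :
    IsTriangular (T : Module.End ℂ (D M)) (vanishing M c) fun n =>
      (selfMapDeriv φ c : ℂ) ^ n := by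
  intro n f hf
  refine mem_vanishing_iff.2 fun k hk => ?_
  have hfk : f ∈ vanishing M c k :=
    (strictAnti_vanishing M c).antitone (Nat.le_of_lt_succ hk) hf
  simp only [ContinuousLinearMap.coe_coe, map_sub, map_smul, smul_eq_mul,
    hφ.derivAt_apply hc hfk]
  obtain rfl | hkn := (Nat.le_of_lt_succ hk).eq_or_lt
  · exact sub_self _
  · simp [mem_vanishing_iff.1 hf k hkn]

theorem abs_selfMapDeriv_lt_one (hφ : IsCompositionOperator T φ) (hT : IsCompactOperator T)
    (hc : φ c = c) : |selfMapDeriv φ c| < 1 := by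
  have h := (hφ.isTriangular hc).tendsto_zero_of_isCompactOperator hT (strictAnti_vanishing M c)
    (isClosed_vanishing M c)
  simpa using tendsto_pow_atTop_nhds_zero_iff_norm_lt_one.1 h

theorem eq_of_apply_eq_self (hφ : IsCompositionOperator T φ) (hT : IsCompactOperator T)
    {a b : unitInterval} (ha : φ a = a) (hb : φ b = b) : a = b := by
  refine Subtype.ext (eq_of_apply_eq_self_of_deriv_lt_one ordConnected_Icc
    (f' := derivWithin (ext fun t => (φ t : ℝ)) (Icc 0 1))
    (fun x hx => hφ.hasDerivWithinAt ⟨x, hx⟩) (fun x hx hfx => ?_) a.2 b.2 ?_ ?_)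
  · rw [ext_apply _ hx] at hfx
    exact (abs_lt.1 (hφ.abs_selfMapDeriv_lt_one hT (c := ⟨x, hx⟩) (Subtype.ext hfx))).2
  · rw [ext_apply _ a.2, ha]
  · rw [ext_apply _ b.2, hb]

theorem tendsto_iterate (hφ : IsCompositionOperator T φ) (hT : IsCompactOperator T)
    (hc : φ c = c) (x : unitInterval) : Tendsto (fun n => φ^[n] x) atTop (𝓝 c) :=
  tendsto_iterate_of_unique_fixed_point_comp_self hφ.continuous
    (fun _ hy => hφ.comp_self.eq_of_apply_eq_self (hT.comp_clm T) hy
      (show φ (φ c) = c by rw [hc, hc])) x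

theorem eventually_dist_le (hφ : IsCompositionOperator T φ) (hc : φ c = c) {ρ : ℝ}
    (hρ : |selfMapDeriv φ c| < ρ) : ∀ᶠ x in 𝓝 c, dist (φ x) c ≤ ρ * dist x c := by
  filter_upwards [(tendsto_coe_nhdsWithin_Icc c).eventually
    ((hφ.hasDerivWithinAt c).limsup_norm_slope_le hρ)] with x hx
  rw [ext_apply _ x.2, ext_apply _ c.2, hc] at hx
  obtain rfl | hxc := eq_or_ne x c
  · simp [hc]
  · rw [inv_mul_lt_iff₀ (norm_pos_iff.2 (sub_ne_zero.2 (Subtype.coe_ne_coe.2 hxc))), mul_comm] at hx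
    exact hx.le

theorem eq_zero_of_flat_of_apply_eq_smul (hφ : IsCompositionOperator T φ)
    (hT : IsCompactOperator T) (hc : φ c = c) {μ : ℂ} (hμ : μ ≠ 0) (hf : T f = μ • f)
    (hflat : ∀ n, f ∈ vanishing M c n) : f = 0 := by
  obtain ⟨ρ, hφρ, hρ1⟩ := exists_between (hφ.abs_selfMapDeriv_lt_one hT hc)
  have hρ0 : 0 ≤ ρ := (abs_nonneg _).trans hφρ.le
  obtain ⟨N, hN⟩ := exists_pow_lt_of_lt_one (norm_pos_iff.2 hμ) hρ1
  have hfφ (x : unitInterval) : f (φ x) = μ • f x := by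
    rw [← hφ, hf]
    rfl
  exact Subtype.ext <| funext fun x =>
    apply_eq_zero_of_isBigO_dist_pow hfφ hρ0 (hφ.eventually_dist_le hc hφρ)
      (isBigO_dist_pow_of_mem_vanishing (hflat (N + 1))) hN (hφ.tendsto_iterate hT hc x)

theorem spectrum_eq (hφ : IsCompositionOperator T φ) (hT : IsCompactOperator T) (hc : φ c = c) :
    spectrum ℂ T = insert 0 (range fun n : ℕ => (selfMapDeriv φ c : ℂ) ^ n) :=
  (hφ.isTriangular hc).spectrum_eq hT (strictAnti_vanishing M c) (vanishing_zero M c)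
    fun _ hμ _ hf hflat => hφ.eq_zero_of_flat_of_apply_eq_smul hT hc hμ hf hflat

end IsCompositionOperator

theorem range_pow_eq_insert_one {G : Type*} [Monoid G] (a : G) :
    range (fun n : ℕ => a ^ n) = insert 1 {z | ∃ n : ℕ, 1 ≤ n ∧ z = a ^ n} := by
  refine Subset.antisymm (range_subset_iff.2 fun n => ?_) (insert_subset ⟨0, pow_zero a⟩ ?_)
  · obtain rfl | hn := n.eq_zero_or_pos
    · exact Or.inl (pow_zero a)
    · exact Or.inr ⟨n, hn, rfl⟩
  · rintro _ ⟨n, -, rfl⟩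
    exact mem_range_self n

end DalesDavie

theorem theorem2p4 (M : DalesDavie.WeightSequence) (φ : unitInterval → unitInterval)
    (T : DalesDavie.D M →ₐ[ℂ] DalesDavie.D M)
    (hTφ : ∀ (f : DalesDavie.D M) (x : unitInterval), (T f) x = f (φ x))
    (hT : IsCompactOperator T.toLinearMap) :
    (∃! x₀ : unitInterval, φ x₀ = x₀) ∧
    ∀ x₀ : unitInterval, φ x₀ = x₀ →
      spectrum ℂ (ContinuousLinearMap.mkOfIsCompactOperator hT) =
        {z : ℂ | ∃ n : ℕ, 1 ≤ n ∧ z = (DalesDavie.selfMapDeriv φ x₀ : ℂ) ^ n} ∪ {0, 1} := by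
  have hφ : DalesDavie.IsCompositionOperator
      (ContinuousLinearMap.mkOfIsCompactOperator hT) φ := hTφ
  refine ⟨?_, fun x₀ hx₀ => ?_⟩
  · obtain ⟨x₀, hx₀⟩ := DalesDavie.exists_apply_eq_self hφ.continuous
    exact ⟨x₀, hx₀, fun y hy => hφ.eq_of_apply_eq_self hT hy hx₀⟩
  · rw [hφ.spectrum_eq hT hx₀, DalesDavie.range_pow_eq_insert_one, Set.union_insert,
      Set.union_singleton]
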